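/- All rooted trees are finite. The edges of a rooted tree are directed away from the root; a leaf is a non-root vertex without children, and $E(T)$ is the set of edges of $T$. **Plucking polynomial.** For a rooted tree $T$ embedded in the upper half plane with its root at the origin (equivalently, with the children of every vertex linearly ordered from left to right), $Q(T)\in\mathbb{Z}[q]$ is defined by $Q(T)=1$ if $T$ is a single point and, if $|E(T)|\ge 1$, $$Q(T)=\sum_{v} q^{\,r(T,v)}\,Q(T-v),$$ where $v$ runs over the leaves of $T$, $r(T,v)$ is the number of edges of $T$ on the right side of the path from the root to $v$, and $T-v$ is $T$ with the leaf $v$ deleted. ($Q(T)$ does not depend on the embedding; the theorem holds for any choice of embeddings.) **Stabilization.** If the root of $T$ has exactly one child, contracting the edge between the root and this child is a *destabilization*; the inverse operation is a *stabilization*. **Permutation move.** For a non-root vertex $w$ of $T$, let $e(w)$ be the number of edges of the branch consisting of the edge from the parent of $w$ to $w$ and everything above $w$; thus $e(w)$ is one more than the number of descendants of $w$. Choose distinct vertices $v_1,\dots,v_n$ of $T$ ($n\ge 0$), a nonempty set $A_i$ of children of $v_i$ for each $i$, and a partition of $A_1\cup\dots\cup A_n$ into nonempty sets $B_1,\dots,B_n$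 with $$\sum_{w\in A_i}e(w)=\sum_{w\in B_i}e(w)\qquad(1\le i\le n).$$ The chosen vertices may be descendants of one another. The *permutation move* cuts off the branches at all $w\in A_1\cup\dots\cup A_n$ and glues, for each $i$, the branches at the $w\in B_i$ to $v_i$; that is, $v_i$ becomes the parent of every $w\in B_i$, and all other parent–child relations are kept. **Theorem 1.2.** Let $T_I$ and $T_{II}$ be two rooted trees. Then $Q(T_I)=Q(T_{II})$ if and only if there are rooted trees $S_I$ and $S_{II}$ such that $S_I$ is obtained from $T_I$ by finitely many stabilizations and destabilizations, $S_{II}$ is obtained from $S_I$ by one permutation move (up to isomorphism of rooted trees), and $T_{II}$ is obtained from $S_{II}$ by finitely many stabilizations and destabilizations. -/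

import Mathlib

open Polynomial

universe u

/-!
A rooted tree is Mathlib's `RootedTree`: the vertices are ordered by `v ≤ w` iff `v` lies on the
path from the root `⊥` to `w`. Thus `v ⋖ w` says that `w` is a child of `v`, and `Set.Ici w` consists
of `w` and its descendants. Every non-root vertex is identified with the edge joining it to its
parent.
-/

/-- An embedding of a rooted tree in the upper half plane, root at the origin, up to isotopy: the
children of every vertex are linearly ordered from left to right. `left a b` says that `a` and `b`
are children of the same vertex and that `a` is to the left of `b`. -/
structure PlaneEmbedding (T : RootedTree.{u}) where
  left : T → T → Prop
  siblings : ∀ a b, left a b → ∃ v : T, v ⋖ a ∧ v ⋖ b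
  irrefl : ∀ a, ¬ left a a
  trans : ∀ a b c, left a b → left b c → left a c
  total : ∀ v a b : T, v ⋖ a → v ⋖ b → a ≠ b → left a b ∨ left b a

namespace PlaneEmbedding

variable {T : RootedTree.{u}}

open Classical in
/-- The leaves of the subtree of `T` with vertex set `s`: the non-root vertices without children
(in a subtree containing the root, a vertex has no children iff it has no descendants). -/
noncomputable def leaves (s : Finset T) : Finset T :=
  {v ∈ s | v ≠ ⊥ ∧ ∀ u ∈ s, ¬ v < u}

open Classical in
/-- The number of edges, in the subtree of `T` with vertex set `s`, on the right side of the path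
from the root to `v`. An edge with upper endpoint `u` is there iff the path to `u` leaves the path
to `v` to the right, that is, it passes through a child `b` of some vertex while the path to `v`
passes through a child `a` of that vertex to the left of `b`. -/
noncomputable def rightEdges (E : PlaneEmbedding T) (s : Finset T) (v : T) : ℕ :=
  Finset.card {u ∈ s | ∃ a b : T, E.left a b ∧ a ≤ v ∧ b ≤ u}

open Classical in
/-- The plucking polynomial of the plane subtree of `T` with vertex set `s`. -/
noncomputable def pluckingAux (E : PlaneEmbedding T) (s : Finset T) : ℤ[X] :=
  if s.card ≤ 1 then 1
  else ∑ v : {v // v ∈ leaves s}, X ^ E.rightEdges s v * E.pluckingAux (s.erase v)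
termination_by s.card
decreasing_by
  exact Finset.card_erase_lt_of_mem (Finset.mem_filter.mp v.2).1

/-- The plucking polynomial `Q(T)`, computed from a plane embedding of `T`. -/
noncomputable def pluckingPolynomial [Fintype T] (E : PlaneEmbedding T) : ℤ[X] :=
  E.pluckingAux Finset.univ

end PlaneEmbedding

/-- `T'` arises from `T` by a destabilization: the root of `T` has exactly one child `w`, and `T'` is
`T` with the edge between the root and `w` contracted, whose vertices are `w`, which becomes the
root, and the descendants of `w`. -/
def IsDestabilization (T T' : RootedTree.{u}) : Prop :=
  ∃ w : T, (∀ x : T, ⊥ ⋖ x ↔ x = w) ∧ Nonempty (Set.Ici w ≃o T')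

/-- `T'` arises from `T` by one stabilization or one destabilization. -/
def IsStabilizationOrDestabilization (T T' : RootedTree.{u}) : Prop :=
  IsDestabilization T T' ∨ IsDestabilization T' T

/-- The number of edges of the subtree hung on the parent of `w` that consists of the edge from
this parent to `w` and everything above `w`. -/
noncomputable def branchEdges {T : RootedTree.{u}} (w : T) : ℕ :=
  (Set.Ici w).ncard

/-- `T'` arises from `T` by a permutation move. Distinct vertices `v i` of `T` are chosen, with a
nonempty set `A i` of children of each. The branches at the elements of the sets `A i` are cut off
and redistributed: those at the elements of `B i` are glued to `v i`, where the nonempty sets `B i`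
form another partition of the union of the sets `A i`. At each `v i` the branches cut off and those
glued on have the same total number of edges (as branches of `T`). The chosen vertices may lie on
the branches that are cut off. The bijection `φ` identifies the vertices of `T` with those of the
resulting tree `T'`. -/
def IsPermutationMove (T T' : RootedTree.{u}) : Prop :=
  ∃ (n : ℕ) (v : Fin n → T) (A B : Fin n → Finset T) (φ : T ≃ T'),
    Function.Injective v ∧
    (∀ i, (A i).Nonempty) ∧
    (∀ i, ∀ w ∈ A i, v i ⋖ w) ∧
    (∀ i, (B i).Nonempty) ∧
    (∀ i j, i ≠ j → Disjoint (B i) (B j)) ∧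
    (∀ w, (∃ i, w ∈ B i) ↔ ∃ i, w ∈ A i) ∧
    (∀ i, ∑ w ∈ A i, branchEdges w = ∑ w ∈ B i, branchEdges w) ∧
    φ ⊥ = ⊥ ∧
    (∀ i, ∀ w ∈ B i, φ (v i) ⋖ φ w) ∧
    (∀ x w, x ⋖ w → (∀ i, w ∉ A i) → φ x ⋖ φ w)

/-! Let `h(w)` be the number of vertices at or above `w`. The `q`-hook length formula says that for
a tree with `N` vertices `Q(T) = [N]! / ∏ [h(w)]`, the product running over all vertices, root
included (`pluckingAux_hook_formula`). So `Q` depends only on the multiset of hook lengths. A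
stabilization adds one vertex of hook length `N + 1`, which cancels the new factor of the factorial.
A permutation move keeps every hook length. Conversely, stabilize both trees to the same number of
vertices. Then equal polynomials give equal products of the `[h(w)]`, and roots of unity recover the
multiset of hook lengths (`Multiset.eq_of_prod_X_pow_sub_one_eq`). Finally, any bijection preserving
hook lengths is itself one permutation move, which regroups all branches at once
(`isPermutationMove_of_equiv`). -/

/-- The `q`-analogue of the natural number `n`. -/
def qNumber {K : Type*} [Semiring K] (q : K) (n : ℕ) : K :=
  ∑ i ∈ Finset.range n, q ^ i

/-! ### Addition of `q`-numbers -/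

section qNumber

variable {K : Type*}

@[simp]
theorem qNumber_zero [Semiring K] (q : K) : qNumber q 0 = 0 := by simp [qNumber]

@[simp]
theorem qNumber_one [Semiring K] (q : K) : qNumber q 1 = 1 := by simp [qNumber]

theorem qNumber_add [CommSemiring K] (q : K) (m n : ℕ) :
    qNumber q (m + n) = qNumber q m + q ^ m * qNumber q n := by
  simp only [qNumber, Finset.sum_range_add, Finset.mul_sum, pow_add]

open Classical in
-- Consecutive blocks of lengths `f c`, laid out from right to left, fill an interval; the exponent
-- is where the block of `c` starts. The induction removes the leftmost block.
theorem sum_pow_mul_qNumber [CommSemiring K] {α : Type*} [Finite α] (q : K) (f : α → ℕ)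
    (r : α → α → Prop) (hirr : ∀ a, ¬ r a a) (htrans : ∀ a b c, r a b → r b c → r a c)
    (C : Finset α) (htotal : ∀ a ∈ C, ∀ b ∈ C, a ≠ b → r a b ∨ r b a) :
    ∑ c ∈ C, q ^ (∑ d ∈ C with r c d, f d) * qNumber q (f c) = qNumber q (∑ c ∈ C, f c) := by
  induction C using Finset.strongInduction with
  | H C ih =>
    obtain rfl | hC := C.eq_empty_or_nonempty
    · simp
    have : IsTrans α r := ⟨htrans⟩
    have : Std.Irrefl r := ⟨hirr⟩
    obtain ⟨m, hm, hmin⟩ :=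
      (Finite.wellFounded_of_trans_of_irrefl r).has_min (C : Set α) hC
    have hm' : m ∈ C := hm
    have hfirst : ∀ c ∈ C, c ≠ m → r m c := fun c hc hne =>
      (htotal c hc m hm' hne).resolve_left (hmin c hc)
    rw [← Finset.sum_erase_add _ _ hm', ← Finset.sum_erase_add C f hm', qNumber_add]
    congr 1
    · rw [← ih _ (Finset.erase_ssubset hm')
        fun a ha b hb => htotal a (Finset.mem_of_mem_erase ha) b (Finset.mem_of_mem_erase hb)]
      refine Finset.sum_congr rfl fun c hc => ?_
      congr 3
      ext d
      simp only [Finset.mem_filter, Finset.mem_erase]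
      refine ⟨fun ⟨hd, h⟩ => ⟨⟨?_, hd⟩, h⟩, fun ⟨⟨_, hd⟩, h⟩ => ⟨hd, h⟩⟩
      rintro rfl
      exact hmin c (Finset.mem_of_mem_erase hc) h
    · congr 3
      ext d
      simp only [Finset.mem_filter, Finset.mem_erase]
      refine ⟨fun ⟨hd, h⟩ => ⟨?_, hd⟩, fun ⟨hne, hd⟩ => ⟨hd, hfirst d hd hne⟩⟩
      rintro rfl
      exact hirr _ h

end qNumber

/-! ### Hook lengths in subtrees -/

namespace RootedTree

variable {T : RootedTree.{u}}

theorem le_of_lt_of_covBy {v a x : T} (h : v ⋖ a) (hx : x < a) : x ≤ v :=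
  h.pred_eq ▸ Order.le_pred_of_lt hx

theorem eq_of_covBy_of_covBy {v w a : T} (hv : v ⋖ a) (hw : w ⋖ a) : v = w :=
  hv.pred_eq.symm.trans hw.pred_eq

theorem eq_of_covBy_of_le {v a b x : T} (ha : v ⋖ a) (hb : v ⋖ b) (hax : a ≤ x) (hbx : b ≤ x) :
    a = b := by
  rcases le_total_of_directed hbx hax with h | h
  · exact h.eq_or_lt.resolve_right fun h => (le_of_lt_of_covBy hb h).not_gt ha.lt
  · exact (h.eq_or_lt.resolve_right fun h => (le_of_lt_of_covBy ha h).not_gt hb.lt).symm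

theorem exists_covBy_le [Finite T] {w u : T} (h : w < u) : ∃ c, w ⋖ c ∧ c ≤ u :=
  exists_covBy_le_of_lt h

open Classical in
/-- The number of vertices of the subtree with vertex set `s` at or above `w`. -/
noncomputable def hookLength (s : Finset T) (w : T) : ℕ :=
  Finset.card {u ∈ s | w ≤ u}

open Classical in
theorem hookLength_pos {s : Finset T} {w : T} (hw : w ∈ s) : 0 < hookLength s w :=
  Finset.card_pos.mpr ⟨w, by simp [hw]⟩

open Classical in
-- A lower set contains the path to each of its vertices, so every vertex of `s` strictly above `w`
-- lies over exactly one child of `w` in `s`.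
theorem hookLength_eq [Finite T] {s : Finset T} (hs : IsLowerSet (s : Set T)) {w : T}
    (hw : w ∈ s) : hookLength s w = (∑ c ∈ s with w ⋖ c, hookLength s c) + 1 := by
  have : ({u ∈ s | w ≤ u} : Finset T) =
      insert w (({c ∈ s | w ⋖ c} : Finset T).biUnion fun c => {u ∈ s | c ≤ u}) := by
    ext u
    simp only [Finset.mem_filter, Finset.mem_insert, Finset.mem_biUnion]
    constructor
    · rintro ⟨hu, hwu⟩
      rcases hwu.eq_or_lt with rfl | hlt
      · exact Or.inl rfl
      · obtain ⟨c, hc, hcu⟩ := exists_covBy_le hlt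
        exact Or.inr ⟨c, ⟨hs hcu hu, hc⟩, hu, hcu⟩
    · rintro (rfl | ⟨c, ⟨_, hc⟩, hu, hcu⟩)
      · exact ⟨hw, le_rfl⟩
      · exact ⟨hu, hc.le.trans hcu⟩
  rw [hookLength, this, Finset.card_insert_of_notMem, Finset.card_biUnion]
  · rfl
  · intro c hc d hd hne
    refine Finset.disjoint_left.mpr fun u hu hu' => hne ?_
    simp only [Finset.coe_filter, Finset.mem_filter, Set.mem_ofPred_eq] at hc hd hu hu'
    exact eq_of_covBy_of_le hc.2 hd.2 hu.2 hu'.2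
  · simp only [Finset.mem_filter, Finset.mem_biUnion, not_exists, not_and]
    exact fun c hc _ hcw => hc.2.lt.not_ge hcw

end RootedTree

/-! ### The `q`-hook length formula -/

namespace PlaneEmbedding

open RootedTree

variable {T : RootedTree.{u}} (E : PlaneEmbedding T)

/-- The path to `u` leaves the path to `v` to the right. -/
def Right (v u : T) : Prop := ∃ a b : T, E.left a b ∧ a ≤ v ∧ b ≤ u

variable {E}

theorem not_left_of_le {a b x : T} (h : E.left a b) (ha : a ≤ x) (hb : b ≤ x) : False := by
  obtain ⟨p, hpa, hpb⟩ := E.siblings a b h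
  exact E.irrefl a (by simpa [eq_of_covBy_of_le hpb hpa hb ha] using h)

theorem not_right_of_le {v u : T} (h : v ≤ u) : ¬ E.Right v u :=
  fun ⟨_, _, hl, ha, hb⟩ => not_left_of_le hl (ha.trans h) hb

theorem not_right_of_ge {v u : T} (h : u ≤ v) : ¬ E.Right v u :=
  fun ⟨_, _, hl, ha, hb⟩ => not_left_of_le hl ha (hb.trans h)

/-- The paths to `v` and `u` part only at `w`: a witnessing pair of siblings other than `c`, `d`
would either contain a vertex lying on both paths or force `c = d`. -/
theorem right_iff {w c d v u : T} (hc : w ⋖ c) (hd : w ⋖ d) (hcd : c ≠ d) (hcv : c ≤ v)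
    (hdu : d ≤ u) : E.Right v u ↔ E.left c d := by
  refine ⟨fun ⟨a, b, hl, ha, hb⟩ => ?_, fun h => ⟨c, d, h, hcv, hdu⟩⟩
  obtain ⟨p, hpa, hpb⟩ := E.siblings a b hl
  have hac : a = c := by
    rcases le_total_of_directed hcv ha with h | h
    · refine h.eq_or_lt.resolve_right fun h => ?_
      exact not_left_of_le hl ((le_of_lt_of_covBy hc h).trans (hd.le.trans hdu)) hb
    · refine (h.eq_or_lt.resolve_right fun h => ?_).symm
      exact hcd (eq_of_covBy_of_le hc hd ((le_of_lt_of_covBy hpa h).trans (hpb.le.trans hb)) hdu)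
  have hbd : b = d := by
    rcases le_total_of_directed hdu hb with h | h
    · refine h.eq_or_lt.resolve_right fun h => ?_
      exact not_left_of_le hl ha ((le_of_lt_of_covBy hd h).trans (hc.le.trans hcv))
    · refine (h.eq_or_lt.resolve_right fun h => ?_).symm
      exact hcd (eq_of_covBy_of_le hc hd hcv ((le_of_lt_of_covBy hpb h).trans (hpa.le.trans ha)))
  rwa [hac, hbd] at hl

open Classical in
theorem card_right_eq [Finite T] {s : Finset T} (hs : IsLowerSet (s : Set T)) {w c v : T}
    (hc : w ⋖ c) (hcv : c ≤ v) :
    Finset.card {u ∈ s | w ≤ u ∧ E.Right v u} =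
      (∑ d ∈ ({d ∈ s | w ⋖ d} : Finset T) with E.left c d, hookLength s d) +
        Finset.card {u ∈ s | c ≤ u ∧ E.Right v u} := by
  have : ({u ∈ s | w ≤ u ∧ E.Right v u} : Finset T) =
      (({d ∈ ({d ∈ s | w ⋖ d} : Finset T) | E.left c d} : Finset T).biUnion
        fun d => {u ∈ s | d ≤ u}) ∪ {u ∈ s | c ≤ u ∧ E.Right v u} := by
    ext u
    simp only [Finset.mem_filter, Finset.mem_union, Finset.mem_biUnion]
    constructor
    · rintro ⟨hu, hwu, hr⟩
      have hlt : w < u := hwu.lt_of_ne (by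
        rintro rfl
        exact not_right_of_ge (hc.le.trans hcv) hr)
      obtain ⟨d, hd, hdu⟩ := exists_covBy_le hlt
      rcases eq_or_ne c d with rfl | hne
      · exact Or.inr ⟨hu, hdu, hr⟩
      · exact Or.inl ⟨d, ⟨⟨hs hdu hu, hd⟩, (right_iff hc hd hne hcv hdu).mp hr⟩, hu, hdu⟩
    · rintro (⟨d, ⟨⟨_, hd⟩, hl⟩, hu, hdu⟩ | ⟨hu, hcu, hr⟩)
      · exact ⟨hu, hd.le.trans hdu, c, d, hl, hcv, hdu⟩
      · exact ⟨hu, hc.le.trans hcu, hr⟩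
  rw [this, Finset.card_union_of_disjoint, Finset.card_biUnion]
  · rfl
  · intro d hd d' hd' hne
    refine Finset.disjoint_left.mpr fun u hu hu' => hne ?_
    simp only [Finset.coe_filter, Finset.mem_filter, Set.mem_ofPred_eq] at hd hd' hu hu'
    exact eq_of_covBy_of_le hd.1.2 hd'.1.2 hu.2 hu'.2
  · refine Finset.disjoint_left.mpr fun u hu hu' => ?_
    simp only [Finset.mem_filter, Finset.mem_biUnion] at hu hu'
    obtain ⟨d, ⟨⟨_, hd⟩, hl⟩, _, hdu⟩ := hu
    exact not_left_of_le hl hu'.2.1 hdu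

variable {K : Type*} [Field K]

open Classical in
-- The factor `[h(u)] / [h(u) - 1]` is the change in the hook product when a leaf above `u` is
-- deleted. Grouping the leaves by the child of `w` below them, the induction hypothesis and
-- `sum_pow_mul_qNumber` leave `[h(w)] / [h(w) - 1]` times `[h(w) - 1]`. The product omits `v`
-- itself, where the denominator would be `[0] = 0`.
theorem sum_leaves_eq [Finite T] (E : PlaneEmbedding T) {q : K}
    (hq : ∀ n, 0 < n → qNumber q n ≠ 0) {s : Finset T}
    (hs : IsLowerSet (s : Set T)) (w : T) (hw : w ∈ s) :
    ∑ v ∈ s with w ≤ v ∧ ∀ u ∈ s, ¬ v < u,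
      q ^ (Finset.card {u ∈ s | w ≤ u ∧ E.Right v u}) *
        ∏ u ∈ s with w ≤ u ∧ u < v, qNumber q (hookLength s u) / qNumber q (hookLength s u - 1) =
      qNumber q (hookLength s w) := by
  induction w using WellFoundedGT.induction with
  | ind w ih =>
    set C : Finset T := {c ∈ s | w ⋖ c} with hC
    have hlen := hookLength_eq hs hw
    rw [← hC] at hlen
    obtain hemp | ⟨c₀, hc₀⟩ := C.eq_empty_or_nonempty
    · have hmax : ∀ u ∈ s, ¬ w < u := fun u hu hlt => by
        obtain ⟨c, hc, hcu⟩ := exists_covBy_le hlt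
        have : c ∈ C := Finset.mem_filter.mpr ⟨hs hcu hu, hc⟩
        simp [hemp] at this
      have hset : ({v ∈ s | w ≤ v ∧ ∀ u ∈ s, ¬ v < u} : Finset T) = {w} := by
        ext v
        simp only [Finset.mem_filter, Finset.mem_singleton]
        refine ⟨fun ⟨hv, hwv, _⟩ => (hwv.eq_or_lt.resolve_right (hmax v hv)).symm, ?_⟩
        rintro rfl
        exact ⟨hw, le_rfl, hmax⟩
      have h₁ : ({u ∈ s | w ≤ u ∧ E.Right w u} : Finset T) = ∅ :=
        Finset.filter_eq_empty_iff.mpr fun u _ h => not_right_of_le h.1 h.2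
      have h₂ : ({u ∈ s | w ≤ u ∧ u < w} : Finset T) = ∅ :=
        Finset.filter_eq_empty_iff.mpr fun u _ h => h.1.not_gt h.2
      rw [hset, Finset.sum_singleton, h₁, h₂, hlen, hemp]
      simp
    · have hset : ({v ∈ s | w ≤ v ∧ ∀ u ∈ s, ¬ v < u} : Finset T) =
          C.biUnion fun c => {v ∈ s | c ≤ v ∧ ∀ u ∈ s, ¬ v < u} := by
        ext v
        simp only [hC, Finset.mem_filter, Finset.mem_biUnion] at hc₀ ⊢
        constructor
        · rintro ⟨hv, hwv, hm⟩
          have hlt : w < v := hwv.lt_of_ne (by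
            rintro rfl
            exact hm c₀ hc₀.1 hc₀.2.lt)
          obtain ⟨c, hc, hcv⟩ := exists_covBy_le hlt
          exact ⟨c, ⟨hs hcv hv, hc⟩, hv, hcv, hm⟩
        · rintro ⟨c, ⟨_, hc⟩, hv, hcv, hm⟩
          exact ⟨hv, hc.le.trans hcv, hm⟩
      have hdisj : (C : Set T).PairwiseDisjoint
          fun c => ({v ∈ s | c ≤ v ∧ ∀ u ∈ s, ¬ v < u} : Finset T) := by
        intro c hc d hd hne
        refine Finset.disjoint_left.mpr fun u hu hu' => hne ?_
        simp only [hC, Finset.coe_filter, Finset.mem_filter, Set.mem_ofPred_eq] at hc hd hu hu'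
        exact eq_of_covBy_of_le hc.2 hd.2 hu.2.1 hu'.2.1
      rw [hset, Finset.sum_biUnion hdisj]
      have hterm : ∀ c ∈ C, ∑ v ∈ s with c ≤ v ∧ ∀ u ∈ s, ¬ v < u,
          q ^ (Finset.card {u ∈ s | w ≤ u ∧ E.Right v u}) *
            ∏ u ∈ s with w ≤ u ∧ u < v,
              qNumber q (hookLength s u) / qNumber q (hookLength s u - 1) =
          qNumber q (hookLength s w) / qNumber q (hookLength s w - 1) *
            (q ^ (∑ d ∈ C with E.left c d, hookLength s d) * qNumber q (hookLength s c)) := by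
        intro c hc
        obtain ⟨hcs, hwc⟩ := Finset.mem_filter.mp hc
        rw [← ih c hwc.lt hcs, Finset.mul_sum, Finset.mul_sum]
        refine Finset.sum_congr rfl fun v hv => ?_
        obtain ⟨hvs, hcv, -⟩ := Finset.mem_filter.mp hv
        have hpath : ({u ∈ s | w ≤ u ∧ u < v} : Finset T) =
            insert w {u ∈ s | c ≤ u ∧ u < v} := by
          ext u
          simp only [Finset.mem_filter, Finset.mem_insert]
          constructor
          · rintro ⟨hu, hwu, huv⟩
            rcases hwu.eq_or_lt with rfl | hlt
            · exact Or.inl rfl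
            · obtain ⟨d, hd, hdu⟩ := exists_covBy_le hlt
              obtain rfl := eq_of_covBy_of_le hwc hd hcv (hdu.trans huv.le)
              exact Or.inr ⟨hu, hdu, huv⟩
          · rintro (rfl | ⟨hu, hcu, huv⟩)
            · exact ⟨hw, le_rfl, hwc.lt.trans_le hcv⟩
            · exact ⟨hu, hwc.le.trans hcu, huv⟩
        rw [card_right_eq hs hwc hcv, hpath, Finset.prod_insert, pow_add]
        · ring
        · simp only [Finset.mem_filter, not_and]
          exact fun _ h => absurd h hwc.lt.not_ge
      rw [Finset.sum_congr rfl hterm, ← Finset.mul_sum, sum_pow_mul_qNumber q (hookLength s)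
        E.left E.irrefl E.trans C fun a ha b hb hab =>
          E.total w a b (Finset.mem_filter.mp ha).2 (Finset.mem_filter.mp hb).2 hab]
      have hpos : 0 < ∑ c ∈ C, hookLength s c :=
        (hookLength_pos (Finset.mem_filter.mp hc₀).1).trans_le
          (Finset.single_le_sum (f := hookLength s) (fun _ _ => Nat.zero_le _) hc₀)
      rw [hlen, Nat.add_sub_cancel, div_mul_cancel₀ _ (hq _ hpos)]

open Classical in
-- Deleting a leaf lowers the hook lengths by one exactly along its path. Each term of the recursion
-- is thus a common factor times a term of `sum_leaves_eq` at the root, whose sum supplies the last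
-- factor `[m + 1]` of the factorial.
theorem pluckingAux_hook_formula [Finite T] (E : PlaneEmbedding T) (φ : ℤ[X] →+* K)
    (hq : ∀ n, 0 < n → qNumber (φ X) n ≠ 0) (s : Finset T) (hbot : ⊥ ∈ s)
    (hs : IsLowerSet (s : Set T)) :
    φ (E.pluckingAux s) =
      (∏ i ∈ Finset.range s.card, qNumber (φ X) (i + 1)) /
        ∏ w ∈ s, qNumber (φ X) (hookLength s w) := by
  induction hn : s.card using Nat.strong_induction_on generalizing s with
  | _ n ih =>
    set q := φ X
    rw [pluckingAux]
    split_ifs with hcard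
    · have hone : s.card = 1 := le_antisymm hcard (Finset.card_pos.mpr ⟨⊥, hbot⟩)
      obtain ⟨a, rfl⟩ := Finset.card_eq_one.mp hone
      obtain rfl : n = 1 := by simpa using hn.symm
      obtain rfl : ⊥ = a := by simpa using hbot
      simp [hookLength, Finset.filter_singleton]
    · obtain ⟨m, rfl⟩ : ∃ m, n = m + 1 := ⟨n - 1, by lia⟩
      rw [Finset.sum_coe_sort (leaves s) fun v => X ^ E.rightEdges s v * E.pluckingAux (s.erase v),
        map_sum]
      have hkey := sum_leaves_eq E hq hs ⊥ hbot
      have hbotlen : hookLength s ⊥ = m + 1 := by simp [hookLength, hn]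
      -- Since `s` has at least two vertices, the root is not maximal and the condition `v ≠ ⊥` is
      -- automatic.
      have hleaves : leaves s = {v ∈ s | ⊥ ≤ v ∧ ∀ u ∈ s, ¬ v < u} := by
        ext v
        simp only [leaves, Finset.mem_filter, bot_le, true_and, and_congr_right_iff,
          and_iff_right_iff_imp]
        rintro hv h rfl
        obtain ⟨u, hu, hne⟩ := Finset.exists_mem_ne (by lia : 1 < s.card) (⊥ : T)
        exact h u hu (bot_lt_iff_ne_bot.mpr hne)
      have hterm : ∀ v ∈ leaves s, φ (X ^ E.rightEdges s v * E.pluckingAux (s.erase v)) =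
          (∏ i ∈ Finset.range m, qNumber q (i + 1)) / (∏ w ∈ s, qNumber q (hookLength s w)) *
          (q ^ (Finset.card {u ∈ s | ⊥ ≤ u ∧ E.Right v u}) *
        ∏ u ∈ s with ⊥ ≤ u ∧ u < v,
          qNumber q (hookLength s u) / qNumber q (hookLength s u - 1)) := by
        intro v hv
        obtain ⟨hvs, hvbot, hmax⟩ := Finset.mem_filter.mp hv
        have hcarde : (s.erase v).card = m := by rw [Finset.card_erase_of_mem hvs, hn]; rfl
        have hlow : IsLowerSet ((s.erase v : Finset T) : Set T) := by
          intro a b hba ha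
          simp only [Finset.coe_erase, Set.mem_sdiff, Finset.mem_coe, Set.mem_singleton_iff] at ha ⊢
          refine ⟨hs hba ha.1, ?_⟩
          rintro rfl
          exact hmax a ha.1 (hba.lt_of_ne (Ne.symm ha.2))
        rw [map_mul, map_pow, ih m (by lia) (s.erase v)
          (Finset.mem_erase.mpr ⟨hvbot.symm, hbot⟩) hlow hcarde]
        have hright : E.rightEdges s v = Finset.card {u ∈ s | ⊥ ≤ u ∧ E.Right v u} := by
          simp [rightEdges, Right]
        have hvlen : hookLength s v = 1 := by
          rw [hookLength, Finset.card_eq_one]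
          refine ⟨v, ?_⟩
          ext u
          simp only [Finset.mem_filter, Finset.mem_singleton]
          refine ⟨fun ⟨hu, h⟩ => (h.eq_or_lt.resolve_right (hmax u hu)).symm, ?_⟩
          rintro rfl
          exact ⟨hvs, le_rfl⟩
        have hfilter : ({u ∈ s | ⊥ ≤ u ∧ u < v} : Finset T) = {u ∈ s.erase v | u ≤ v} := by
          ext u
          simp only [Finset.mem_filter, Finset.mem_erase, bot_le, true_and, lt_iff_le_and_ne]
          tauto
        have herase : ∀ u ∈ s.erase v, qNumber q (hookLength s u) =
            qNumber q (hookLength (s.erase v) u) *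
            (if u ≤ v then qNumber q (hookLength s u) / qNumber q (hookLength s u - 1)
              else 1) := by
          intro u hu
          have : hookLength (s.erase v) u = hookLength s u - if u ≤ v then 1 else 0 := by
            rw [hookLength, hookLength, Finset.filter_erase]
            split_ifs with h
            · rw [Finset.card_erase_of_mem (by simp [hvs, h])]
            · rw [Finset.erase_eq_of_notMem (by simp [h]), Nat.sub_zero]
          split_ifs with h
          · rw [if_pos h] at this
            rw [← this, mul_div_cancel₀ _ (hq _ (hookLength_pos hu))]
          · rw [this, if_neg h, Nat.sub_zero, mul_one]
        have hprod : ∏ w ∈ s, qNumber q (hookLength s w) =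
            (∏ w ∈ s.erase v, qNumber q (hookLength (s.erase v) w)) *
            ∏ u ∈ s with ⊥ ≤ u ∧ u < v,
              qNumber q (hookLength s u) / qNumber q (hookLength s u - 1) := by
          rw [← Finset.prod_erase_mul _ _ hvs, hvlen, qNumber_one, mul_one,
            Finset.prod_congr rfl herase, Finset.prod_mul_distrib, hfilter, Finset.prod_filter]
        have hne : ∏ w ∈ s, qNumber q (hookLength s w) ≠ 0 :=
          Finset.prod_ne_zero_iff.mpr fun w hw => hq _ (hookLength_pos hw)
        rw [hright]
        rw [hprod] at hne ⊢
        have h₁ := left_ne_zero_of_mul hne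
        have h₂ := right_ne_zero_of_mul hne
        field_simp
        exact mul_comm _ _
      rw [Finset.sum_congr rfl hterm, ← Finset.mul_sum, hleaves, hkey, hbotlen,
        Finset.prod_range_succ]
      ring

end PlaneEmbedding

/-! ### Invariance of the hook quotient under the moves -/

namespace RootedTree

variable {T T' : RootedTree.{u}}

theorem hookLength_univ [Fintype T] (w : T) : hookLength Finset.univ w = branchEdges w := by
  classical
  rw [branchEdges, hookLength, ← Set.ncard_coe_finset]
  congr 1
  ext u
  simp

open Classical in
theorem branchEdges_eq [Fintype T] (w : T) :
    branchEdges w = (∑ c : T with w ⋖ c, branchEdges c) + 1 := by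
  simp_rw [← hookLength_univ]
  exact hookLength_eq (by simpa using isLowerSet_univ) (Finset.mem_univ w)

theorem branchEdges_pos [Finite T] (w : T) : 0 < branchEdges w :=
  (Set.ncard_pos (Set.toFinite _)).mpr ⟨w, le_rfl⟩

theorem branchEdges_bot : branchEdges (⊥ : T) = Nat.card T := by
  rw [branchEdges, Set.Ici_bot, Set.ncard_univ]

theorem eq_bot_of_branchEdges_eq [Finite T] {w : T} (h : branchEdges w = Nat.card T) : w = ⊥ := by
  have := Set.eq_of_subset_of_ncard_le (Set.subset_univ (Set.Ici w))
    (by rw [Set.ncard_univ, ← h, branchEdges])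
  exact le_bot_iff.mp (this ▸ Set.mem_univ (⊥ : T) : (⊥ : T) ∈ Set.Ici w)

theorem one_lt_branchEdges_iff [Finite T] {w : T} : 1 < branchEdges w ↔ ∃ c, w ⋖ c := by
  rw [branchEdges, Set.one_lt_ncard_iff_nontrivial]
  constructor
  · intro h
    obtain ⟨u, hu, hne⟩ := h.exists_ne w
    obtain ⟨c, hc, -⟩ := exists_covBy_le (lt_of_le_of_ne hu hne.symm)
    exact ⟨c, hc⟩
  · rintro ⟨c, hc⟩
    exact ⟨w, le_rfl, c, hc.le, hc.lt.ne⟩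

theorem exists_covBy {w : T} (h : w ≠ ⊥) : ∃ v : T, v ⋖ w :=
  ⟨Order.pred w, Order.pred_covBy_of_not_isMin (by simpa using h)⟩

theorem not_covBy_bot (v : T) : ¬ v ⋖ ⊥ := fun h => not_lt_bot h.lt

/-- The quotient in the `q`-hook length formula. -/
noncomputable def hookQuotient {K : Type*} [Field K] (q : K) (T : RootedTree.{u}) : K :=
  (∏ i ∈ Finset.range (Nat.card T), qNumber q (i + 1)) / ∏ᶠ w : T, qNumber q (branchEdges w)

theorem _root_.PlaneEmbedding.map_pluckingPolynomial [Fintype T] (E : PlaneEmbedding T)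
    {K : Type*} [Field K] (φ : ℤ[X] →+* K) (hq : ∀ n, 0 < n → qNumber (φ X) n ≠ 0) :
    φ E.pluckingPolynomial = hookQuotient (φ X) T := by
  rw [PlaneEmbedding.pluckingPolynomial, PlaneEmbedding.pluckingAux_hook_formula E φ hq _
    (Finset.mem_univ _) (by simpa using isLowerSet_univ), hookQuotient,
    finprod_eq_prod_of_fintype, Finset.card_univ, Nat.card_eq_fintype_card]
  simp_rw [hookLength_univ]

/-- Everything except the root lies above its only child, so only the root disappears and no other
hook length changes. -/
theorem _root_.IsDestabilization.exists_equiv (h : IsDestabilization T T') :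
    ∃ e : Option T' ≃ T, e none = ⊥ ∧ ∀ y, branchEdges (e (some y)) = branchEdges y := by
  obtain ⟨w, hw, ⟨ψ⟩⟩ := h
  have hwpos : ⊥ < w := ((hw w).mpr rfl).lt
  have hle : ∀ x : T, x ≠ ⊥ → w ≤ x := fun x hx => by
    obtain ⟨a, ha, hax⟩ := (eq_bot_or_exists_atom_le x).resolve_left hx
    rwa [(hw a).mp (bot_covBy_iff.mpr ha)] at hax
  let f : Option T' → T := fun o => o.elim ⊥ fun y => (ψ.symm y).1
  have hf : Function.Bijective f := by
    constructor
    · rintro (_ | y) (_ | z) hyz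
      · rfl
      · exact absurd ((ψ.symm z).2.trans_eq hyz.symm) hwpos.not_ge
      · exact absurd ((ψ.symm y).2.trans_eq hyz) hwpos.not_ge
      · exact congrArg some (ψ.symm.injective (Subtype.ext hyz))
    · intro x
      rcases eq_or_ne x ⊥ with rfl | hx
      · exact ⟨none, rfl⟩
      · exact ⟨some (ψ ⟨x, hle x hx⟩), by simp [f]⟩
  refine ⟨Equiv.ofBijective f hf, rfl, fun y => ?_⟩
  have himage : Set.Ici (f (some y)) = (fun z => f (some z)) '' Set.Ici y := by
    ext x
    constructor
    · intro hx
      refine ⟨ψ ⟨x, (ψ.symm y).2.trans hx⟩, ?_, by simp [f]⟩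
      exact ψ.symm_apply_le.mp hx
    · rintro ⟨z, hz, rfl⟩
      exact ψ.symm.monotone hz
  change branchEdges (f (some y)) = _
  rw [branchEdges, himage, branchEdges]
  exact Set.ncard_image_of_injective _ (hf.injective.comp (Option.some_injective _))

theorem _root_.IsDestabilization.finite_iff (h : IsDestabilization T T') :
    Finite T ↔ Finite T' := by
  obtain ⟨e, -⟩ := h.exists_equiv
  exact ⟨fun _ => Finite.of_injective _ (e.injective.comp (Option.some_injective _)),
    fun _ => Finite.of_equiv _ e⟩

theorem _root_.IsDestabilization.card_eq (h : IsDestabilization T T') [Finite T'] :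
    Nat.card T = Nat.card T' + 1 := by
  obtain ⟨e, -⟩ := h.exists_equiv
  rw [← Nat.card_congr e, Finite.card_option]

variable {K : Type*} [Field K] {q : K}

theorem _root_.IsDestabilization.hookQuotient_eq (h : IsDestabilization T T') [Finite T']
    (hq : ∀ n, 0 < n → qNumber q n ≠ 0) : hookQuotient q T = hookQuotient q T' := by
  have hcard := h.card_eq
  obtain ⟨e, hbot, he⟩ := h.exists_equiv
  have := Fintype.ofFinite T'
  have := Fintype.ofEquiv _ e
  rw [hookQuotient, hookQuotient, finprod_eq_prod_of_fintype, finprod_eq_prod_of_fintype,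
    ← e.prod_comp, Fintype.prod_option, hbot, branchEdges_bot, hcard, Finset.prod_range_succ,
    mul_comm, mul_div_mul_left _ _ (hq _ (Nat.succ_pos _))]
  simp_rw [he]

theorem _root_.Relation.ReflTransGen.finite_and_hookQuotient_eq
    (h : Relation.ReflTransGen IsStabilizationOrDestabilization T T') [hT : Finite T]
    (hq : ∀ n, 0 < n → qNumber q n ≠ 0) :
    Finite T' ∧ hookQuotient q T = hookQuotient q T' := by
  induction h with
  | refl => exact ⟨hT, rfl⟩
  | tail _ hstep ih =>
    obtain ⟨hfin, heq⟩ := ih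
    rcases hstep with h | h
    · have := h.finite_iff.mp hfin
      exact ⟨this, heq.trans (h.hookQuotient_eq hq)⟩
    · exact ⟨h.finite_iff.mpr hfin, heq.trans (h.hookQuotient_eq hq).symm⟩

/-- The sum condition makes the old hook lengths of the new children of each vertex add up to those
of its old children. Induction from the leaves of `T'` down to its root then shows that hook lengths
are unchanged. -/
theorem _root_.IsPermutationMove.exists_equiv (h : IsPermutationMove T T') [Finite T] :
    ∃ φ : T ≃ T', ∀ x, branchEdges (φ x) = branchEdges x := by
  classical
  obtain ⟨n, v, A, B, φ, hv, -, hA, -, -, hAB, hsum, hbot, hB, hkeep⟩ := h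
  have := Fintype.ofFinite T
  have := Fintype.ofEquiv _ φ
  -- Parents are unique, so the prescribed parent relations are the only ones in `T'`.
  have hcover : ∀ x c, φ x ⋖ φ c → (∃ i, x = v i ∧ c ∈ B i) ∨ x ⋖ c ∧ ∀ i, c ∉ A i := by
    intro x c hxc
    by_cases hc : ∃ i, c ∈ A i
    · obtain ⟨k, hk⟩ := (hAB c).mpr hc
      exact Or.inl ⟨k, φ.injective (eq_of_covBy_of_covBy hxc (hB k c hk)), hk⟩
    · rw [not_exists] at hc
      have hne : c ≠ ⊥ := by
        rintro rfl
        exact not_covBy_bot _ (hbot ▸ hxc)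
      obtain ⟨p, hp⟩ := exists_covBy hne
      obtain rfl := φ.injective (eq_of_covBy_of_covBy hxc (hkeep p c hp hc))
      exact Or.inr ⟨hp, hc⟩
  have hchildren : ∀ x, ∑ c : T with φ x ⋖ φ c, branchEdges c =
      ∑ c : T with x ⋖ c, branchEdges c := by
    intro x
    by_cases hx : ∃ i, x = v i
    · obtain ⟨i, rfl⟩ := hx
      have hAi : ∀ c, v i ⋖ c → ∀ j, c ∈ A j → c ∈ A i := fun c hc j hj => by
        rwa [hv (eq_of_covBy_of_covBy hc (hA j c hj))]
      have hsub : A i ⊆ ({c | v i ⋖ c} : Finset T) := fun c hc => by simpa using hA i c hc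
      have hset : ({c | φ (v i) ⋖ φ c} : Finset T) = B i ∪ (({c | v i ⋖ c} : Finset T) \ A i) := by
        ext c
        simp only [Finset.mem_filter, Finset.mem_univ, true_and, Finset.mem_union,
          Finset.mem_sdiff]
        constructor
        · intro hc
          rcases hcover _ _ hc with ⟨j, hj, hcj⟩ | ⟨hc, hcA⟩
          · exact Or.inl (hv hj ▸ hcj)
          · exact Or.inr ⟨hc, hcA i⟩
        · rintro (hc | ⟨hc, hcA⟩)
          · exact hB i c hc
          · exact hkeep _ _ hc fun j hj => hcA (hAi c hc j hj)
      have hdisj : Disjoint (B i) (({c | v i ⋖ c} : Finset T) \ A i) := by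
        refine Finset.disjoint_left.mpr fun c hc hc' => ?_
        simp only [Finset.mem_filter, Finset.mem_univ, true_and, Finset.mem_sdiff] at hc'
        obtain ⟨j, hj⟩ := (hAB c).mp ⟨i, hc⟩
        exact hc'.2 (hAi c hc'.1 j hj)
      rw [hset, Finset.sum_union hdisj, ← hsum i, add_comm, Finset.sum_sdiff hsub]
    · congr 1
      ext c
      simp only [Finset.mem_filter, Finset.mem_univ, true_and]
      constructor
      · intro hc
        exact ((hcover x c hc).resolve_left fun ⟨i, hi, _⟩ => hx ⟨i, hi⟩).1
      · exact fun hc => hkeep x c hc fun i hi => hx ⟨i, eq_of_covBy_of_covBy hc (hA i c hi)⟩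
  have main : ∀ y : T', branchEdges y = branchEdges (φ.symm y) := by
    intro y
    induction y using WellFoundedGT.induction with
    | ind y ih =>
      rw [branchEdges_eq y, branchEdges_eq (φ.symm y), ← hchildren, φ.apply_symm_apply]
      congr 1
      refine Finset.sum_equiv φ.symm (by simp) fun c hc => ih c ?_
      exact (Finset.mem_filter.mp hc).2.lt
  exact ⟨φ, fun x => by simp [main]⟩

theorem _root_.IsPermutationMove.hookQuotient_eq (h : IsPermutationMove T T') [Finite T] :
    hookQuotient q T = hookQuotient q T' := by
  obtain ⟨φ, hφ⟩ := h.exists_equiv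
  rw [hookQuotient, hookQuotient, Nat.card_congr φ]
  congr 1
  exact finprod_eq_of_bijective φ φ.bijective fun x => by rw [hφ]

end RootedTree

/-! ### Recovering the hook lengths -/

theorem exists_equiv_of_map_eq {α β γ : Type*} [Fintype α] [Fintype β] {f : α → γ} {g : β → γ}
    (h : Finset.univ.val.map f = Finset.univ.val.map g) : ∃ e : α ≃ β, ∀ x, g (e x) = f x := by
  classical
  have hcard : ∀ c, Nonempty ({a // f a = c} ≃ {b // g b = c}) := fun c => by
    refine ⟨Fintype.equivOfCardEq ?_⟩
    have := congrArg (Multiset.count c) h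
    rw [Multiset.count_map, Multiset.count_map] at this
    rw [Fintype.card_subtype, Fintype.card_subtype]
    simpa [Finset.card_def, Finset.filter_val, eq_comm] using this
  exact ⟨Equiv.ofFiberEquiv fun c => (hcard c).some, fun x => Equiv.ofFiberEquiv_map _ x⟩

theorem Multiset.eq_of_prod_X_pow_sub_one_eq {s t : Multiset ℕ} (hs : ∀ m ∈ s, 0 < m)
    (ht : ∀ m ∈ t, 0 < m)
    (h : (s.map fun m => (X ^ m - 1 : ℂ[X])).prod = (t.map fun m => (X ^ m - 1 : ℂ[X])).prod) :
    s = t := by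
  have hne : ∀ m, 0 < m → (X ^ m - 1 : ℂ[X]) ≠ 0 := fun m hm => X_pow_sub_C_ne_zero hm 1
  -- A primitive `m`-th root of unity is a zero of one product, hence of the other.
  have hnonempty : ∀ {u v : Multiset ℕ}, (∀ m ∈ v, 0 < m) →
      (u.map fun m => (X ^ m - 1 : ℂ[X])).prod = (v.map fun m => (X ^ m - 1 : ℂ[X])).prod →
      ∀ m ∈ u, 0 < m → ∃ k ∈ v, m ∣ k := by
    intro u v _ h m hm hpos
    have hζ := Complex.isPrimitiveRoot_exp m hpos.ne'
    have h₀ : ((u.map fun m => (X ^ m - 1 : ℂ[X])).prod).eval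
        (Complex.exp (2 * Real.pi * Complex.I / m)) = 0 := by
      rw [eval_multiset_prod, Multiset.prod_eq_zero_iff]
      simp only [Multiset.map_map, Multiset.mem_map, Function.comp_apply]
      exact ⟨m, hm, by simp [hζ.pow_eq_one]⟩
    rw [h, eval_multiset_prod, Multiset.prod_eq_zero_iff] at h₀
    simp only [Multiset.map_map, Multiset.mem_map, Function.comp_apply] at h₀
    obtain ⟨k, hk, hk₀⟩ := h₀
    exact ⟨k, hk, hζ.dvd_of_pow_eq_one k (sub_eq_zero.mp (by simpa using hk₀))⟩
  induction hn : s.card generalizing s t with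
  | zero =>
    obtain rfl := Multiset.card_eq_zero.mp hn
    refine (Multiset.eq_zero_of_forall_notMem fun m hm => ?_).symm
    obtain ⟨k, hk, -⟩ := hnonempty hs h.symm m hm (ht m hm)
    simp at hk
  | succ n ih =>
    have hs₀ : s ≠ 0 := by rintro rfl; simp at hn
    obtain ⟨a, ha⟩ := Multiset.exists_mem_of_ne_zero hs₀
    obtain ⟨m, hm, hmax⟩ := s.toFinset.exists_max_image id ⟨a, by simpa using ha⟩
    rw [Multiset.mem_toFinset] at hm
    obtain ⟨k, hk, hmk⟩ := hnonempty ht h m hm (hs m hm)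
    obtain ⟨l, hl, hkl⟩ := hnonempty hs h.symm k hk (ht k hk)
    -- `m` divides `k`, which divides some `l` in `s`, and `m` is the largest element of `s`.
    have hkm : k = m := le_antisymm
      ((Nat.le_of_dvd (hs l hl) hkl).trans (hmax l (by simpa using hl)))
      (Nat.le_of_dvd (ht k hk) hmk)
    subst hkm
    obtain ⟨s', rfl⟩ := Multiset.exists_cons_of_mem hm
    obtain ⟨t', rfl⟩ := Multiset.exists_cons_of_mem hk
    rw [Multiset.map_cons, Multiset.map_cons, Multiset.prod_cons, Multiset.prod_cons] at h
    rw [ih (fun m hm => hs m (Multiset.mem_cons_of_mem hm))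
      (fun m hm => ht m (Multiset.mem_cons_of_mem hm))
      (mul_left_cancel₀ (hne k (ht k hk)) h) (by simpa using hn)]

/-! ### Constructing the moves -/

namespace RootedTree

variable {T T' : RootedTree.{u}}

/-- All vertices with children are chosen and all their branches cut. Both sums at `v i` equal its
hook length minus one. Hook lengths also detect the root and the vertices with children, which makes
the `B i` a partition into nonempty sets. -/
theorem isPermutationMove_of_equiv [Finite T] (f : T ≃ T')
    (hf : ∀ x, branchEdges (f x) = branchEdges x) : IsPermutationMove T T' := by
  classical
  have := Fintype.ofFinite T
  have := Fintype.ofEquiv _ f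
  have hbot : f ⊥ = ⊥ :=
    eq_bot_of_branchEdges_eq (by rw [hf, branchEdges_bot, Nat.card_congr f])
  have hchild : ∀ x, (∃ c, x ⋖ c) ↔ ∃ c, f x ⋖ f c := fun x => by
    rw [← one_lt_branchEdges_iff, ← hf, one_lt_branchEdges_iff, f.surjective.exists]
  let e := Fintype.equivFin {x : T // ∃ c, x ⋖ c}
  have hv : ∀ x c, x ⋖ c → ∃ i, (e.symm i).1 = x := fun x c hc => ⟨e ⟨x, c, hc⟩, by simp⟩
  refine ⟨_, fun i => (e.symm i).1, fun i => {c | (e.symm i).1 ⋖ c},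
    fun i => {c | f (e.symm i).1 ⋖ f c}, f, Subtype.val_injective.comp e.symm.injective,
    fun i => ?_, fun i w hw => ?_, fun i => ?_, fun i j hij => ?_, fun w => ?_, fun i => ?_, hbot,
    fun i w hw => ?_, fun x w hw hA => ?_⟩
  · obtain ⟨c, hc⟩ := (e.symm i).2
    exact ⟨c, by simpa using hc⟩
  · simpa using hw
  · obtain ⟨c, hc⟩ := (hchild _).mp (e.symm i).2
    exact ⟨c, by simpa using hc⟩
  · refine Finset.disjoint_left.mpr fun c hc hc' => hij ?_
    simp only [Finset.mem_filter, Finset.mem_univ, true_and] at hc hc'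
    exact e.symm.injective (Subtype.ext (f.injective (eq_of_covBy_of_covBy hc hc')))
  · simp only [Finset.mem_filter, Finset.mem_univ, true_and]
    constructor
    · rintro ⟨i, hi⟩
      have hne : w ≠ ⊥ := by
        rintro rfl
        exact not_covBy_bot _ (hbot ▸ hi)
      obtain ⟨p, hp⟩ := exists_covBy hne
      obtain ⟨j, rfl⟩ := hv p w hp
      exact ⟨j, hp⟩
    · rintro ⟨i, hi⟩
      have hne : f w ≠ ⊥ := by
        rw [← hbot, f.injective.ne_iff]
        rintro rfl
        exact not_covBy_bot _ hi
      obtain ⟨p, hp⟩ := exists_covBy hne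
      obtain ⟨p, rfl⟩ := f.surjective p
      obtain ⟨c, hc⟩ := (hchild p).mpr ⟨w, hp⟩
      obtain ⟨j, rfl⟩ := hv p c hc
      exact ⟨j, hp⟩
  · have h₁ := branchEdges_eq (e.symm i).1
    have h₂ := branchEdges_eq (f (e.symm i).1)
    rw [hf, h₁, Nat.add_right_cancel_iff] at h₂
    rw [h₂]
    exact (Finset.sum_equiv f (by simp) fun c _ => (hf c).symm).symm
  · simpa using hw
  · obtain ⟨i, rfl⟩ := hv x w hw
    exact absurd hw (by simpa using hA i)

theorem exists_isDestabilization (T : RootedTree.{u}) [Finite T] :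
    ∃ S : RootedTree.{u}, IsDestabilization S T := by
  classical
  have : Finite (WithBot T) := inferInstanceAs (Finite (Option T))
  -- The new bottom is the root, and the old root is its only child.
  refine ⟨⟨WithBot T⟩, ((⊥ : T) : WithBot T), fun x => ?_, ⟨?_⟩⟩
  · change (⊥ : WithBot T) ⋖ x ↔ _
    induction x using WithBot.recBotCoe with
    | bot => simp
    | coe x => rw [WithBot.bot_covBy_coe, isMin_iff_eq_bot, WithBot.coe_inj]
  · refine OrderIso.symm ⟨Equiv.ofBijective
      (fun y => ⟨(y : WithBot T), WithBot.coe_le_coe.mpr bot_le⟩) ⟨fun a b h => ?_, ?_⟩, ?_⟩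
    · exact WithBot.coe_injective (congrArg Subtype.val h)
    · rintro ⟨x, hx⟩
      obtain ⟨y, rfl⟩ := WithBot.ne_bot_iff_exists.mp ((WithBot.bot_lt_coe (⊥ : T)).trans_le
        (show ((⊥ : T) : WithBot T) ≤ x from hx)).ne'
      exact ⟨y, rfl⟩
    · exact WithBot.coe_le_coe

theorem exists_stabilization (T : RootedTree.{u}) [hT : Finite T] (k : ℕ) :
    ∃ S : RootedTree.{u}, Relation.ReflTransGen IsStabilizationOrDestabilization T S ∧
      Finite S ∧ Nat.card S = Nat.card T + k := by
  induction k with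
  | zero => exact ⟨T, .refl, hT, rfl⟩
  | succ k ih =>
    obtain ⟨S, hS, hfin, hcard⟩ := ih
    obtain ⟨S', hS'⟩ := exists_isDestabilization S
    exact ⟨S', hS.tail (Or.inr hS'), hS'.finite_iff.mpr hfin, by rw [hS'.card_eq, hcard, add_assoc]⟩

theorem isPermutationMove_of_hookQuotient_eq [Finite T] [Finite T']
    (hcard : Nat.card T = Nat.card T') {K : Type*} [Field K] {φ : ℤ[X] →+* K}
    (hφ : Function.Injective φ) (hq : ∀ n, 0 < n → qNumber (φ X) n ≠ 0)
    (h : hookQuotient (φ X) T = hookQuotient (φ X) T') : IsPermutationMove T T' := by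
  have := Fintype.ofFinite T
  have := Fintype.ofFinite T'
  have hnum : ∏ i ∈ Finset.range (Nat.card T'), qNumber (φ X) (i + 1) ≠ 0 :=
    Finset.prod_ne_zero_iff.mpr fun i _ => hq _ i.succ_pos
  have hden : ∏ w : T, qNumber (φ X) (branchEdges w) = ∏ w : T', qNumber (φ X) (branchEdges w) := by
    rw [hookQuotient, hookQuotient, hcard, finprod_eq_prod_of_fintype,
      finprod_eq_prod_of_fintype] at h
    exact inv_injective (mul_left_cancel₀ hnum (by simpa only [div_eq_mul_inv] using h))
  -- Multiplying by one factor `q - 1` per vertex turns each `[h]` into `q ^ h - 1`.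
  have hmul : ∀ S : RootedTree.{u}, ∀ _ : Fintype S,
      (∏ w : S, qNumber (φ X) (branchEdges w)) * (φ X - 1) ^ Nat.card S =
        φ (∏ w : S, (X ^ branchEdges w - 1)) := fun S _ => by
    simp_rw [Nat.card_eq_fintype_card, ← Finset.card_univ, ← Finset.prod_const,
      ← Finset.prod_mul_distrib, qNumber, geom_sum_mul]
    simp
  have hprod : ∏ w : T, (X ^ branchEdges w - 1 : ℤ[X]) = ∏ w : T', (X ^ branchEdges w - 1) :=
    hφ (by rw [← hmul, ← hmul, hden, hcard])
  have hmap := congrArg (Polynomial.map (Int.castRingHom ℂ)) hprod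
  simp only [Polynomial.map_prod, Polynomial.map_sub, Polynomial.map_pow, map_X,
    Polynomial.map_one] at hmap
  obtain ⟨f, hf⟩ := exists_equiv_of_map_eq (f := fun w : T => branchEdges w)
    (g := fun w : T' => branchEdges w) (by
      refine Multiset.eq_of_prod_X_pow_sub_one_eq ?_ ?_ ?_
      · simpa using branchEdges_pos
      · simpa using branchEdges_pos
      · rw [Multiset.map_map, Multiset.map_map]
        exact hmap)
  exact isPermutationMove_of_equiv f hf

end RootedTree

/-! ### The theorem, over the fraction field of `ℤ[X]` -/

theorem qNumber_algebraMap_X_ne_zero (n : ℕ) (hn : 0 < n) :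
    qNumber (algebraMap ℤ[X] (FractionRing ℤ[X]) X) n ≠ 0 := by
  have : qNumber (algebraMap ℤ[X] (FractionRing ℤ[X]) X) n =
      algebraMap ℤ[X] (FractionRing ℤ[X]) (qNumber X n) := by simp [qNumber]
  rw [this, map_ne_zero_iff _ (IsFractionRing.injective _ _)]
  intro h
  -- At `q = 1` the `q`-number `[n]` takes the value `n`.
  have := congrArg (eval 1) h
  simp [qNumber, eval_finsetSum] at this
  exact hn.ne' this

theorem theorem1p2 (T₁ T₂ : RootedTree.{u}) [Fintype T₁] [Fintype T₂]
    (E₁ : PlaneEmbedding T₁) (E₂ : PlaneEmbedding T₂) :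
    E₁.pluckingPolynomial = E₂.pluckingPolynomial ↔
      ∃ S₁ S₂ : RootedTree.{u},
        Relation.ReflTransGen IsStabilizationOrDestabilization T₁ S₁ ∧
        IsPermutationMove S₁ S₂ ∧
        Relation.ReflTransGen IsStabilizationOrDestabilization S₂ T₂ := by
  have hq := qNumber_algebraMap_X_ne_zero
  have hinj : Function.Injective (algebraMap ℤ[X] (FractionRing ℤ[X])) :=
    IsFractionRing.injective _ _
  rw [← hinj.eq_iff, E₁.map_pluckingPolynomial _ hq, E₂.map_pluckingPolynomial _ hq]
  constructor
  · intro h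
    -- Each tree is stabilized as often as the other has vertices, which makes the sizes equal.
    obtain ⟨S₁, h₁, hfin₁, hcard₁⟩ := RootedTree.exists_stabilization T₁ (Nat.card T₂)
    obtain ⟨S₂, h₂, hfin₂, hcard₂⟩ := RootedTree.exists_stabilization T₂ (Nat.card T₁)
    refine ⟨S₁, S₂, h₁, RootedTree.isPermutationMove_of_hookQuotient_eq
      (by rw [hcard₁, hcard₂, add_comm]) hinj hq ?_, ?_⟩
    · rw [← (h₁.finite_and_hookQuotient_eq hq).2, h, (h₂.finite_and_hookQuotient_eq hq).2]
    · have : Std.Symm IsStabilizationOrDestabilization.{u} := ⟨fun _ _ => Or.symm⟩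
      exact Std.Symm.symm _ _ h₂
  · rintro ⟨S₁, S₂, h₁, hmove, h₂⟩
    obtain ⟨hfin₁, heq₁⟩ := h₁.finite_and_hookQuotient_eq hq
    obtain ⟨φ, -⟩ := hmove.exists_equiv
    have : Finite S₂ := Finite.of_equiv _ φ
    rw [heq₁, hmove.hookQuotient_eq, (h₂.finite_and_hookQuotient_eq hq).2]
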